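/- Let $N\ge 1$, let $H$ be a Hermitian $N\times N$ complex matrix, and let $(V_d)_d$ be a finite family of complex $N\times N$ matrices. Consider the Lindblad master equation $$\dot\rho(t)=\mathcal L\rho(t),\qquad \mathcal L\rho=-i(H\rho-\rho H)+\sum_d\Big(V_d\rho V_d^\dagger-\tfrac12\big(V_d^\dagger V_d\rho+\rho V_d^\dagger V_d\big)\Big).$$ A state is a positive semidefinite $N\times N$ matrix of trace one, and a steady state is a state $\rho$ with $\mathcal L\rho=0$. A steady state $\rho_{\rm ss}$ is called attractive if every solution $\rho(t)$, $t\ge 0$, of the master equation whose initial value $\rho(0)$ is a state satisfies $\rho(t)\to\rho_{\rm ss}$ as $t\to\infty$. Let $(\sigma_k)_{1\le k\le N^2-1}$ be Hermitian matrices with $\operatorname{Tr}\sigma_k=0$ and $\operatorname{Tr}(\sigma_k\sigma_l)=\delta_{kl}$ (that is, an orthonormal basis of the real space of traceless Hermitian matrices, for example the normalized generalized Pauli matrices). The Bloch operator in this basis is the real $(N^2-1)\times(N^2-1)$ matrix $A$ with entries $$A_{mn}=\operatorname{Tr}\big(iH[\sigma_m,\sigma_n]\big)+\sum_d\Big(\operatorname{Tr}\big(V_d^\dagger\sigma_mV_d\sigma_n\big)-\tfrac12\operatorname{Tr}\big(V_d^\dagger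 V_d(\sigma_m\sigma_n+\sigma_n\sigma_m)\big)\Big),$$ where $[X,Y]=XY-YX$. Theorem. Let $\rho_{\rm ss}$ be a steady state. 1. $\rho_{\rm ss}$ is attractive if and only if it is the unique steady state. 2. If $\rho_{\rm ss}$ is the unique steady state, then it is not a center: for every such basis $(\sigma_k)$ and every real $\alpha>0$, neither $i\alpha$ nor $-i\alpha$ is a (complex) eigenvalue of the Bloch operator $A$. -/

import Mathlib

open Matrix Set Filter Topology
open scoped ComplexOrder

noncomputable section

namespace Lindblad

variable {N : ℕ} {ι : Type*} [Fintype ι]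

/-- Physical states (density operators): positive operators of unit trace on `ℂ^N`. -/
def IsState (ρ : Matrix (Fin N) (Fin N) ℂ) : Prop :=
  ρ.PosSemidef ∧ ρ.trace = 1

/-- The dissipator `D[V] ρ = V ρ V† - (V† V ρ + ρ V† V) / 2`. -/
def dissipator (V ρ : Matrix (Fin N) (Fin N) ℂ) : Matrix (Fin N) (Fin N) ℂ :=
  V * ρ * Vᴴ - (1 / 2 : ℂ) • (Vᴴ * V * ρ + ρ * (Vᴴ * V))

/-- The right-hand side of the Lindblad master equation,
`L ρ = -i [H, ρ] + ∑ d, D[V d] ρ`. -/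
def generator (H : Matrix (Fin N) (Fin N) ℂ) (V : ι → Matrix (Fin N) (Fin N) ℂ)
    (ρ : Matrix (Fin N) (Fin N) ℂ) : Matrix (Fin N) (Fin N) ℂ :=
  (-Complex.I) • (H * ρ - ρ * H) + ∑ d, dissipator (V d) ρ

/-- Solutions of the master equation `dρ/dt = L ρ` on `[0, ∞)`, started at a physical state
(the derivative is taken entrywise, and is one-sided at `t = 0`). -/
structure IsSolution (H : Matrix (Fin N) (Fin N) ℂ) (V : ι → Matrix (Fin N) (Fin N) ℂ)
    (ρ : ℝ → Matrix (Fin N) (Fin N) ℂ) : Prop where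
  initial : IsState (ρ 0)
  evolution : ∀ t : ℝ, 0 ≤ t → ∀ i j : Fin N,
    HasDerivWithinAt (fun s => ρ s i j) (generator H V (ρ t) i j) (Ici 0) t

/-- Steady states: physical states `ρ` with `L ρ = 0`. -/
def IsSteadyState (H : Matrix (Fin N) (Fin N) ℂ) (V : ι → Matrix (Fin N) (Fin N) ℂ)
    (ρ : Matrix (Fin N) (Fin N) ℂ) : Prop :=
  IsState ρ ∧ generator H V ρ = 0

/-- `ρss` is attractive: all solutions converge to it. -/
def IsAttractive (H : Matrix (Fin N) (Fin N) ℂ) (V : ι → Matrix (Fin N) (Fin N) ℂ)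
    (ρss : Matrix (Fin N) (Fin N) ℂ) : Prop :=
  ∀ ρ : ℝ → Matrix (Fin N) (Fin N) ℂ, IsSolution H V ρ → Tendsto ρ atTop (𝓝 ρss)

/-- The first `N ^ 2 - 1` elements of an orthonormal basis of the real space of Hermitian
`N × N` matrices (with inner product `Tr (A B)`) whose last element is `I / √N`: orthogonality to
`I / √N` means trace zero, and `N ^ 2 - 1` orthonormal elements exhaust the traceless Hermitian
matrices. The normalized generalized Pauli matrices are an example. -/
structure IsBlochBasis (σ : Fin (N ^ 2 - 1) → Matrix (Fin N) (Fin N) ℂ) : Prop where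
  isHermitian : ∀ k, (σ k).IsHermitian
  trace_eq_zero : ∀ k, (σ k).trace = 0
  orthonormal : ∀ k l, (σ k * σ l).trace = if k = l then 1 else 0

/-- The Bloch operator: the real `(N ^ 2 - 1) × (N ^ 2 - 1)` matrix
`A m n = Tr (i H [σ m, σ n])
  + ∑ d, (Tr (V d† σ m V d σ n) - Tr (V d† V d {σ m, σ n}) / 2)`.
All these traces are real for Hermitian `H` and `σ`; `re` only changes their type. -/
def blochOperator (H : Matrix (Fin N) (Fin N) ℂ) (V : ι → Matrix (Fin N) (Fin N) ℂ)
    (σ : Fin (N ^ 2 - 1) → Matrix (Fin N) (Fin N) ℂ) :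
    Matrix (Fin (N ^ 2 - 1)) (Fin (N ^ 2 - 1)) ℝ :=
  Matrix.of fun m n =>
    (((Complex.I • H) * (σ m * σ n - σ n * σ m)).trace
      + ∑ d, (((V d)ᴴ * σ m * V d * σ n).trace
        - (1 / 2 : ℂ) * ((V d)ᴴ * V d * (σ m * σ n + σ n * σ m)).trace)).re

/-- The complex number `z` is an eigenvalue of the real matrix `A`. -/
def IsComplexEigenvalue {k : ℕ} (A : Matrix (Fin k) (Fin k) ℝ) (z : ℂ) : Prop :=
  Module.End.HasEigenvalue (Matrix.toLin' (A.map Complex.ofReal)) z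

end Lindblad

end

/-!
Write `K = -iH - ½ ∑ V†V`, so that `L X = K X + X K† + ∑ V X V†`, with adjoint
`L* A = K† A + A K + ∑ V† A V` for the pairing `Tr (A X)`, and `L* 1 = 0`.

Everything rests on a maximum principle for `L*` (`posSemidef_of_smul_sub_heisenbergMap`): if `A` is
Hermitian, `c > 0` and `c A - L* A ≥ 0`, then `A ≥ 0`. It makes `(1 - L)⁻¹` a positive
trace-preserving map, and such a map fixes the positive and the negative part of every Hermitian
matrix in `ker L`. Hence, if the steady state `ρ` is unique, `ker L = ℂ ρ`
(`eq_trace_smul_of_schrodingerMap_eq_zero`), the range of `L*` is `{Z | Tr (ρ Z) = 0}`, and a second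
use of the maximum principle shows that `L* Z ≥ 0` implies `Z ≤ Tr (ρ Z)`
(`neg_posSemidef_of_subharmonic`). The steady state need not be faithful; this bound replaces a
decomposition along its support.

Let `L* X = z X` with `X ≠ 0` and `0 ≤ re z`. The dissipation identity
`L* (X†X) = 2 (re z) X†X + ∑ [V, X]†[V, X]` shows that `X†X` is subharmonic. With
`s = Tr (ρ X†X)` it follows that `re z = 0`, `X†X ρ = s ρ` and `[V, X] ρ = 0`. Then
`[K, X] ρ = -z X ρ`, so `X ρ X†` is in `ker L` and equals `s ρ`; comparing the traces of `K X ρ X†`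
and `s K ρ` gives `z = 0` (`eq_zero_of_heisenbergMap_eq_smul`). By duality the spectrum of `L` on
traceless matrices lies in the open left half-plane (`re_neg_of_schrodingerMap_eq_smul`).

Convergence of all solutions follows from linear stability theory
(`tendsto_zero_of_hasDerivWithinAt`). The Bloch operator is the matrix of `L` on traceless matrices
in the basis `σ`, so it has no imaginary eigenvalues. Conversely, a second steady state is a
constant solution that does not converge to the first.
-/

namespace Lindblad

/-! ### Positive semidefinite matrices and the trace -/

section PosSemidef

variable {n : Type*} [Fintype n]

lemma _root_.Matrix.PosSemidef.exists_conjTranspose_mul_self {A : Matrix n n ℂ}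
    (hA : A.PosSemidef) : ∃ C : Matrix n n ℂ, A = Cᴴ * C := by
  classical
  open scoped MatrixOrder in
  obtain ⟨C, hC⟩ := CStarAlgebra.nonneg_iff_eq_star_mul_self.mp hA.nonneg
  exact ⟨C, hC⟩

lemma _root_.Matrix.PosSemidef.trace_mul_nonneg {A B : Matrix n n ℂ}
    (hA : A.PosSemidef) (hB : B.PosSemidef) : 0 ≤ (A * B).trace := by
  obtain ⟨C, rfl⟩ := hB.exists_conjTranspose_mul_self
  rw [← Matrix.mul_assoc, trace_mul_comm, ← Matrix.mul_assoc]
  exact (hA.mul_mul_conjTranspose_same C).trace_nonneg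

lemma _root_.Matrix.PosSemidef.mul_eq_zero_of_trace_mul_eq_zero {A B : Matrix n n ℂ}
    (hA : A.PosSemidef) (hB : B.PosSemidef) (h : (A * B).trace = 0) : A * B = 0 := by
  obtain ⟨C, rfl⟩ := hB.exists_conjTranspose_mul_self
  obtain ⟨D, rfl⟩ := hA.exists_conjTranspose_mul_self
  have hDC : D * Cᴴ = 0 := by
    rw [← trace_conjTranspose_mul_self_eq_zero_iff, conjTranspose_mul, conjTranspose_conjTranspose,
      ← h, trace_mul_comm (Dᴴ * D)]
    rw [Matrix.mul_assoc, Matrix.mul_assoc Cᴴ, trace_mul_comm Cᴴ]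
    simp only [Matrix.mul_assoc]
  calc Dᴴ * D * (Cᴴ * C) = Dᴴ * (D * Cᴴ) * C := by simp only [Matrix.mul_assoc]
    _ = 0 := by simp [hDC]

lemma trace_mul_vecMulVec_star (M : Matrix n n ℂ) (v : n → ℂ) :
    (M * vecMulVec v (star v)).trace = star v ⬝ᵥ (M *ᵥ v) := by
  rw [mul_vecMulVec, trace_vecMulVec, dotProduct_comm]

lemma _root_.Matrix.IsHermitian.posSemidef_of_trace_mul_vecMulVec_nonneg {M : Matrix n n ℂ}
    (hM : M.IsHermitian) (h : ∀ v, 0 ≤ (M * vecMulVec v (star v)).trace) : M.PosSemidef :=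
  .of_dotProduct_mulVec_nonneg hM fun v => by
    rw [← trace_mul_vecMulVec_star]; exact h v

variable [DecidableEq n]

lemma _root_.Matrix.IsHermitian.exists_unitary_diagonal {A : Matrix n n ℂ}
    (hA : A.IsHermitian) : ∃ (U : Matrix n n ℂ) (e : n → ℝ), U * Uᴴ = 1 ∧ Uᴴ * U = 1 ∧
      A = U * diagonal (fun j => (e j : ℂ)) * Uᴴ := by
  refine ⟨hA.eigenvectorUnitary, hA.eigenvalues, Unitary.coe_mul_star_self _,
    Unitary.coe_star_mul_self _, ?_⟩
  conv_lhs => rw [hA.spectral_theorem, Unitary.conjStarAlgAut_apply]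
  rfl

lemma _root_.Matrix.IsHermitian.exists_least_eigenvalue [Nonempty n] {A : Matrix n n ℂ}
    (hA : A.IsHermitian) : ∃ (r : ℝ) (v : n → ℂ), v ≠ 0 ∧ A *ᵥ v = (r : ℂ) • v ∧
      (A - (r : ℂ) • 1).PosSemidef := by
  obtain ⟨U, e, hU, hU', rfl⟩ := hA.exists_unitary_diagonal
  obtain ⟨i, hi⟩ := Finite.exists_min e
  refine ⟨e i, U *ᵥ Pi.single i 1, ?_, ?_, ?_⟩
  · intro h
    have h1 : Uᴴ *ᵥ (U *ᵥ Pi.single i 1) = 0 := by rw [h, mulVec_zero]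
    rw [mulVec_mulVec, hU', one_mulVec] at h1
    simpa using congrFun h1 i
  · have hd : diagonal (fun j => (e j : ℂ)) *ᵥ Pi.single i 1 = (e i : ℂ) • Pi.single i 1 := by
      ext j
      by_cases hj : j = i
      · subst hj; simp
      · simp [hj]
    rw [mulVec_mulVec, Matrix.mul_assoc, hU', Matrix.mul_one, ← mulVec_mulVec, hd, mulVec_smul]
  · have : U * diagonal (fun j => (e j : ℂ)) * Uᴴ - (e i : ℂ) • 1
        = U * diagonal (fun j => ((e j - e i : ℝ) : ℂ)) * Uᴴ := by
      have hd : diagonal (fun j => ((e j - e i : ℝ) : ℂ)) =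
          diagonal (fun j => (e j : ℂ)) - (e i : ℂ) • (1 : Matrix n n ℂ) := by
        ext a b
        by_cases hab : a = b <;> simp [Matrix.diagonal, hab]
      rw [hd, Matrix.mul_sub, Matrix.sub_mul]
      simp [hU]
    rw [this]
    refine PosSemidef.mul_mul_conjTranspose_same (PosSemidef.diagonal fun j => ?_) _
    have := sub_nonneg.mpr (hi j)
    simpa only [Pi.zero_apply, Complex.zero_le_real] using this

/-- Jordan decomposition: `P` is the spectral projection of `A` for `[0, ∞)`, the positive part of
`A` is `P * A` and its negative part is `P * A - A`. -/
lemma _root_.Matrix.IsHermitian.exists_jordan_projection {A : Matrix n n ℂ}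
    (hA : A.IsHermitian) : ∃ P : Matrix n n ℂ, P.PosSemidef ∧ (1 - P).PosSemidef ∧
      (P * A).PosSemidef ∧ (P * A - A).PosSemidef := by
  obtain ⟨U, e, hU, hU', hAe⟩ := hA.exists_unitary_diagonal
  set f : n → ℂ := fun j => if 0 ≤ e j then 1 else 0 with hf
  have key : ∀ d : n → ℂ, 0 ≤ d → (U * diagonal d * Uᴴ).PosSemidef := fun d hd =>
    PosSemidef.mul_mul_conjTranspose_same (PosSemidef.diagonal hd) _
  have hPA : U * diagonal f * Uᴴ * A = U * diagonal (fun j => f j * (e j : ℂ)) * Uᴴ := by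
    rw [hAe, ← diagonal_mul_diagonal]
    calc _ = U * diagonal f * (Uᴴ * U) * diagonal (fun j => (e j : ℂ)) * Uᴴ := by
          simp only [Matrix.mul_assoc]
      _ = _ := by rw [hU']; simp only [Matrix.mul_assoc, Matrix.mul_one]
  refine ⟨U * diagonal f * Uᴴ, key _ fun j => ?_, ?_, ?_, ?_⟩
  · simp only [hf, Pi.zero_apply]; split_ifs <;> simp
  · have : 1 - U * diagonal f * Uᴴ = U * diagonal (fun j => 1 - f j) * Uᴴ := by
      rw [← diagonal_sub, diagonal_one, Matrix.mul_sub, Matrix.sub_mul, Matrix.mul_one, hU]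
    rw [this]
    refine key _ fun j => ?_
    simp only [hf, Pi.zero_apply]; split_ifs <;> simp
  · rw [hPA]
    refine key _ fun j => ?_
    simp only [hf, Pi.zero_apply]; split_ifs with h <;> simp [h]
  · have : U * diagonal f * Uᴴ * A - A
        = U * diagonal (fun j => f j * (e j : ℂ) - (e j : ℂ)) * Uᴴ := by
      rw [hPA, ← diagonal_sub, Matrix.mul_sub, Matrix.sub_mul, ← hAe]
    rw [this]
    refine key _ fun j => ?_
    simp only [hf, Pi.zero_apply]; split_ifs with h
    · simp
    · have := (not_le.mp h).le
      simpa [-Complex.coe_algebraMap] using Complex.real_le_real.mpr this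

end PosSemidef

/-! ### Adjoints for the trace pairing -/

section Duality

/-- Every matrix is `S + i T` with `S` and `T` Hermitian. -/
lemma exists_isHermitian_add_I_smul {n : Type*} (X : Matrix n n ℂ) :
    ∃ S T : Matrix n n ℂ, S.IsHermitian ∧ T.IsHermitian ∧ X = S + Complex.I • T ∧
      S = (1 / 2 : ℂ) • (X + Xᴴ) ∧ T = (-Complex.I / 2) • (X - Xᴴ) := by
  refine ⟨_, _, ?_, ?_, ?_, rfl, rfl⟩
  · simp [IsHermitian, add_comm]
  · simp [IsHermitian, ← smul_neg, neg_div]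
  · ext i j
    simp
    ring_nf
    simp
    ring

variable {n : Type*} [Fintype n]

lemma _root_.Matrix.eq_zero_of_forall_trace_mul_eq_zero {X : Matrix n n ℂ}
    (h : ∀ A : Matrix n n ℂ, (A * X).trace = 0) : X = 0 := by
  rw [← trace_conjTranspose_mul_self_eq_zero_iff]; exact h _

/-- A surjective map has an injective adjoint for the trace pairing; in finite dimension the
adjoint is then surjective. -/
lemma surjective_of_trace_adjoint {F G : Matrix n n ℂ →ₗ[ℂ] Matrix n n ℂ}
    (h : ∀ A X, (A * F X).trace = (G A * X).trace) (hF : Function.Surjective F) :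
    Function.Surjective G := by
  rw [← LinearMap.injective_iff_surjective]
  rw [← LinearMap.ker_eq_bot, LinearMap.ker_eq_bot']
  intro A hA
  refine eq_zero_of_forall_trace_mul_eq_zero fun B => ?_
  obtain ⟨X, rfl⟩ := hF B
  rw [trace_mul_comm, h, hA]; simp

end Duality

/-! ### The generator in both pictures and the maximum principle -/

section Maps

variable {n κ : Type*} [Fintype n] [Fintype κ]

/-- The Lindblad generator in the Schrödinger picture, with the Hamiltonian and the
anticommutator part of the dissipators collected in `K = -iH - ½ ∑ V†V`. -/
def schrodingerMap (K : Matrix n n ℂ) (V : κ → Matrix n n ℂ) :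
    Matrix n n ℂ →ₗ[ℂ] Matrix n n ℂ where
  toFun X := K * X + X * Kᴴ + ∑ d, V d * X * (V d)ᴴ
  map_add' X Y := by
    simp only [Matrix.mul_add, Matrix.add_mul, Finset.sum_add_distrib]; abel
  map_smul' c X := by
    simp only [Matrix.mul_smul, Matrix.smul_mul, ← Finset.smul_sum, ← smul_add, RingHom.id_apply]

/-- The Lindblad generator in the Heisenberg picture: the adjoint of `schrodingerMap` for the
trace pairing. -/
def heisenbergMap (K : Matrix n n ℂ) (V : κ → Matrix n n ℂ) :
    Matrix n n ℂ →ₗ[ℂ] Matrix n n ℂ where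
  toFun A := Kᴴ * A + A * K + ∑ d, (V d)ᴴ * A * V d
  map_add' X Y := by
    simp only [Matrix.mul_add, Matrix.add_mul, Finset.sum_add_distrib]; abel
  map_smul' c X := by
    simp only [Matrix.mul_smul, Matrix.smul_mul, ← Finset.smul_sum, ← smul_add, RingHom.id_apply]

variable {K : Matrix n n ℂ} {V : κ → Matrix n n ℂ}

lemma schrodingerMap_apply (X : Matrix n n ℂ) :
    schrodingerMap K V X = K * X + X * Kᴴ + ∑ d, V d * X * (V d)ᴴ := rfl

lemma heisenbergMap_apply (A : Matrix n n ℂ) :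
    heisenbergMap K V A = Kᴴ * A + A * K + ∑ d, (V d)ᴴ * A * V d := rfl

lemma schrodingerMap_conjTranspose (X : Matrix n n ℂ) :
    schrodingerMap K V Xᴴ = (schrodingerMap K V X)ᴴ := by
  simp only [schrodingerMap_apply, conjTranspose_add, conjTranspose_mul, conjTranspose_sum,
    conjTranspose_conjTranspose, Matrix.mul_assoc]
  abel

lemma heisenbergMap_conjTranspose (X : Matrix n n ℂ) :
    heisenbergMap K V Xᴴ = (heisenbergMap K V X)ᴴ := by
  simp only [heisenbergMap_apply, conjTranspose_add, conjTranspose_mul, conjTranspose_sum,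
    conjTranspose_conjTranspose, Matrix.mul_assoc]
  abel

lemma trace_mul_schrodingerMap (A X : Matrix n n ℂ) :
    (A * schrodingerMap K V X).trace = (heisenbergMap K V A * X).trace := by
  simp only [schrodingerMap_apply, heisenbergMap_apply, Matrix.mul_add, Matrix.add_mul,
    trace_add, Matrix.mul_sum, Matrix.sum_mul, trace_sum]
  have h1 : (A * (X * Kᴴ)).trace = (Kᴴ * A * X).trace := by
    rw [← Matrix.mul_assoc, trace_mul_comm, Matrix.mul_assoc]
  have h2 : (A * (K * X)).trace = (A * K * X).trace := by rw [Matrix.mul_assoc]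
  have h3 : ∀ d, (A * (V d * X * (V d)ᴴ)).trace = ((V d)ᴴ * A * V d * X).trace := fun d => by
    rw [← Matrix.mul_assoc, trace_mul_comm]; simp only [Matrix.mul_assoc]
  rw [h1, h2, Finset.sum_congr rfl fun d _ => h3 d]
  ring

/-- The generator with its zero mode `ρ` shifted to the eigenvalue `-1`; it agrees with the
generator on traceless matrices. -/
def shiftedMap (K : Matrix n n ℂ) (V : κ → Matrix n n ℂ) (ρ : Matrix n n ℂ) :
    Matrix n n ℂ →ₗ[ℂ] Matrix n n ℂ :=
  schrodingerMap K V - (traceLinearMap n ℂ ℂ).smulRight ρ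

lemma shiftedMap_apply (ρ X : Matrix n n ℂ) :
    shiftedMap K V ρ X = schrodingerMap K V X - X.trace • ρ := rfl

variable [DecidableEq n]

lemma heisenbergMap_one (hK : K + Kᴴ + ∑ d, (V d)ᴴ * V d = 0) : heisenbergMap K V 1 = 0 := by
  rw [heisenbergMap_apply, ← hK]; simp [add_comm]

lemma trace_schrodingerMap (hK : K + Kᴴ + ∑ d, (V d)ᴴ * V d = 0) (X : Matrix n n ℂ) :
    (schrodingerMap K V X).trace = 0 := by
  have := trace_mul_schrodingerMap (K := K) (V := V) 1 X
  rwa [heisenbergMap_one hK, Matrix.one_mul, Matrix.zero_mul, trace_zero] at this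

/-- The maximum principle: at an eigenvector of `A` for its least eigenvalue, the expectation of
`L* A` is nonnegative, so that eigenvalue cannot be negative when `L* A ≤ c A`. -/
lemma posSemidef_of_smul_sub_heisenbergMap (hK : K + Kᴴ + ∑ d, (V d)ᴴ * V d = 0)
    {A : Matrix n n ℂ} (hA : A.IsHermitian) {c : ℝ} (hc : 0 < c)
    (h : ((c : ℂ) • A - heisenbergMap K V A).PosSemidef) : A.PosSemidef := by
  cases isEmpty_or_nonempty n
  · rw [Subsingleton.elim A 0]; exact .zero
  obtain ⟨r, v, hv, hAv, hB⟩ := hA.exists_least_eigenvalue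
  set B := A - (r : ℂ) • (1 : Matrix n n ℂ) with hBdef
  set W := vecMulVec v (star v) with hW
  have hWpos : W.PosSemidef := posSemidef_vecMulVec_self_star v
  have hAB : A = B + (r : ℂ) • (1 : Matrix n n ℂ) := by simp [hBdef]
  have hBv : B *ᵥ v = 0 := by
    rw [hBdef, sub_mulVec, hAv, smul_mulVec, one_mulVec, sub_self]
  have hBW : B * W = 0 := by rw [hW, mul_vecMulVec, hBv, zero_vecMulVec]
  have hWB : W * B = 0 := by
    have := congrArg conjTranspose hBW
    rwa [conjTranspose_mul, hB.1.eq, hWpos.1.eq, conjTranspose_zero] at this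
  have hLB : 0 ≤ (heisenbergMap K V B * W).trace := by
    rw [← trace_mul_schrodingerMap, schrodingerMap_apply, Matrix.mul_add, Matrix.mul_add,
      trace_add, trace_add, trace_mul_comm B (K * W), Matrix.mul_assoc K, hWB,
      ← Matrix.mul_assoc B, hBW, Matrix.mul_sum, trace_sum]
    simp only [Matrix.mul_zero, Matrix.zero_mul, trace_zero, zero_add]
    exact Finset.sum_nonneg fun d _ =>
      hB.trace_mul_nonneg (hWpos.mul_mul_conjTranspose_same (V d))
  have hLA : heisenbergMap K V A = heisenbergMap K V B := by
    rw [hAB, map_add, map_smul, heisenbergMap_one hK, smul_zero, add_zero]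
  have h1 := h.trace_mul_nonneg hWpos
  rw [hLA, Matrix.sub_mul, trace_sub, hAB, smul_add, Matrix.add_mul, Matrix.smul_mul, hBW,
    smul_smul, Matrix.smul_mul, Matrix.one_mul, smul_zero, zero_add, trace_smul] at h1
  have h2 : 0 ≤ ((c * r : ℝ) : ℂ) * W.trace := by
    have := add_nonneg h1 hLB
    rw [sub_add_cancel, smul_eq_mul] at this
    exact_mod_cast this
  have hWt : 0 < W.trace := by
    rw [hW, trace_vecMulVec, dotProduct_comm]
    exact dotProduct_star_self_pos_iff.mpr hv
  have h3 : 0 ≤ ((c * r : ℝ) : ℂ) := by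
    have := mul_nonneg h2 (inv_nonneg.mpr hWt.le)
    rwa [mul_inv_cancel_right₀ hWt.ne'] at this
  have hr : 0 ≤ r := nonneg_of_mul_nonneg_right (Complex.zero_le_real.mp h3) hc
  rw [hAB]
  exact hB.add (PosSemidef.one.smul (Complex.zero_le_real.mpr hr))

lemma eq_zero_of_heisenbergMap_eq_self (hK : K + Kᴴ + ∑ d, (V d)ᴴ * V d = 0)
    {A : Matrix n n ℂ} (h : heisenbergMap K V A = A) : A = 0 := by
  have key : ∀ S : Matrix n n ℂ, S.IsHermitian → heisenbergMap K V S = S → S = 0 := by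
    intro S hS hLS
    have h1 : S.PosSemidef := posSemidef_of_smul_sub_heisenbergMap hK hS one_pos
      (by simpa [hLS] using PosSemidef.zero)
    have h2 : (-S).PosSemidef := posSemidef_of_smul_sub_heisenbergMap hK hS.neg one_pos
      (by simpa [hLS] using PosSemidef.zero)
    refine h1.trace_eq_zero_iff.mp (le_antisymm ?_ h1.trace_nonneg)
    have := h2.trace_nonneg
    rwa [trace_neg, neg_nonneg] at this
  obtain ⟨S, T, hS, hT, hX, rfl, rfl⟩ := exists_isHermitian_add_I_smul A
  rw [hX, key _ hS, key _ hT, smul_zero, add_zero]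
  · rw [map_smul, map_sub, heisenbergMap_conjTranspose, h]
  · rw [map_smul, map_add, heisenbergMap_conjTranspose, h]

/-- The maximum principle excludes `1` from the spectrum of `L*`. -/
lemma surjective_id_sub_heisenbergMap (hK : K + Kᴴ + ∑ d, (V d)ᴴ * V d = 0) :
    Function.Surjective ((LinearMap.id : Matrix n n ℂ →ₗ[ℂ] Matrix n n ℂ) - heisenbergMap K V) := by
  rw [← LinearMap.injective_iff_surjective, ← LinearMap.ker_eq_bot, LinearMap.ker_eq_bot']
  intro A hA
  exact eq_zero_of_heisenbergMap_eq_self hK (sub_eq_zero.mp hA).symm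

lemma surjective_id_sub_schrodingerMap (hK : K + Kᴴ + ∑ d, (V d)ᴴ * V d = 0) :
    Function.Surjective
      ((LinearMap.id : Matrix n n ℂ →ₗ[ℂ] Matrix n n ℂ) - schrodingerMap K V) := by
  refine surjective_of_trace_adjoint (fun A X => ?_) (surjective_id_sub_heisenbergMap hK)
  simp only [LinearMap.sub_apply, LinearMap.id_apply, Matrix.mul_sub, Matrix.sub_mul, trace_sub]
  rw [trace_mul_comm A (heisenbergMap K V X), ← trace_mul_schrodingerMap, trace_mul_comm X]

lemma eq_zero_of_schrodingerMap_eq_self (hK : K + Kᴴ + ∑ d, (V d)ᴴ * V d = 0)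
    {X : Matrix n n ℂ} (h : schrodingerMap K V X = X) : X = 0 := by
  have := LinearMap.injective_iff_surjective.mpr (surjective_id_sub_schrodingerMap hK)
  refine this ?_
  simp [h]

/-- Positivity of the resolvent `(1 - L)⁻¹` in the Schrödinger picture, by duality with the
maximum principle. -/
lemma posSemidef_of_sub_schrodingerMap (hK : K + Kᴴ + ∑ d, (V d)ᴴ * V d = 0)
    {Y : Matrix n n ℂ} (h : (Y - schrodingerMap K V Y).PosSemidef) : Y.PosSemidef := by
  have hY : Y.IsHermitian := by
    have h1 : schrodingerMap K V (Yᴴ - Y) = Yᴴ - Y := by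
      have := h.1.eq
      rw [conjTranspose_sub, ← schrodingerMap_conjTranspose,
        sub_eq_sub_iff_add_eq_add] at this
      rw [map_sub, sub_eq_sub_iff_add_eq_add, add_comm _ Y, ← this]
    exact sub_eq_zero.mp (eq_zero_of_schrodingerMap_eq_self hK h1)
  refine hY.posSemidef_of_trace_mul_vecMulVec_nonneg fun v => ?_
  have hWpos : (vecMulVec v (star v)).PosSemidef := posSemidef_vecMulVec_self_star v
  obtain ⟨B, hB⟩ := surjective_id_sub_heisenbergMap hK (vecMulVec v (star v))
  rw [LinearMap.sub_apply, LinearMap.id_apply] at hB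
  have hBh : B.IsHermitian := by
    have h1 : heisenbergMap K V (Bᴴ - B) = Bᴴ - B := by
      have := hWpos.1.eq
      rw [← hB, conjTranspose_sub, ← heisenbergMap_conjTranspose,
        sub_eq_sub_iff_add_eq_add] at this
      rw [map_sub, sub_eq_sub_iff_add_eq_add, add_comm _ B, ← this]
    exact sub_eq_zero.mp (eq_zero_of_heisenbergMap_eq_self hK h1)
  have hBpos : B.PosSemidef :=
    posSemidef_of_smul_sub_heisenbergMap hK hBh one_pos (by simpa [hB] using hWpos)
  have := hBpos.trace_mul_nonneg h
  rwa [Matrix.mul_sub, trace_sub, trace_mul_schrodingerMap, ← trace_sub, ← Matrix.sub_mul, hB,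
    trace_mul_comm] at this

end Maps

/-! ### Consequences of a unique steady state -/

section SteadyStates

variable {n κ : Type*} [Fintype n] [Fintype κ] [DecidableEq n]
variable {K : Matrix n n ℂ} {V : κ → Matrix n n ℂ}

/-- The positive part of a Hermitian element of `ker L` lies in `ker L`: the positive
trace-preserving map `(1 - L)⁻¹` fixes `X`, hence cannot mix the supports of its positive and
negative parts. -/
lemma exists_posSemidef_decomposition_of_schrodingerMap_eq_zero
    (hK : K + Kᴴ + ∑ d, (V d)ᴴ * V d = 0) {X : Matrix n n ℂ} (hX : X.IsHermitian)
    (h : schrodingerMap K V X = 0) :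
    ∃ Y Z : Matrix n n ℂ, Y.PosSemidef ∧ Z.PosSemidef ∧ schrodingerMap K V Y = 0 ∧
      schrodingerMap K V Z = 0 ∧ X = Y - Z := by
  obtain ⟨P, hP, hQ, hPX, hQX⟩ := hX.exists_jordan_projection
  -- `Y` and `Y - X` are the images under `(1 - L)⁻¹` of the positive and negative parts of `X`
  obtain ⟨Y, hY⟩ := surjective_id_sub_schrodingerMap hK (P * X)
  rw [LinearMap.sub_apply, LinearMap.id_apply] at hY
  have hYpos : Y.PosSemidef := posSemidef_of_sub_schrodingerMap hK (by rwa [hY])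
  have hZpos : (Y - X).PosSemidef := posSemidef_of_sub_schrodingerMap hK (by
    rwa [map_sub, h, sub_zero, sub_right_comm, hY])
  have htr : Y.trace = (P * X).trace := by
    rw [← hY, trace_sub, trace_schrodingerMap hK, sub_zero]
  have h1 := hP.trace_mul_nonneg hZpos
  have h2 := hQ.trace_mul_nonneg hYpos
  have hsum : (P * (Y - X)).trace + ((1 - P) * Y).trace = 0 := by
    rw [Matrix.mul_sub, Matrix.sub_mul, Matrix.one_mul, trace_sub, trace_sub, htr]; ring
  have hPZ := hP.mul_eq_zero_of_trace_mul_eq_zero hZpos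
    ((add_eq_zero_iff_of_nonneg h1 h2).mp hsum).1
  have hQY := hQ.mul_eq_zero_of_trace_mul_eq_zero hYpos
    ((add_eq_zero_iff_of_nonneg h1 h2).mp hsum).2
  rw [Matrix.mul_sub, sub_eq_zero] at hPZ
  rw [Matrix.sub_mul, Matrix.one_mul, sub_eq_zero] at hQY
  have hLY : schrodingerMap K V Y = 0 := by
    rw [← hPZ, ← hQY, sub_eq_self] at hY
    exact hY
  exact ⟨Y, Y - X, hYpos, hZpos, hLY, by rw [map_sub, hLY, h, sub_zero], by simp⟩

/-- Uniqueness of the steady state makes the whole complex kernel of `L` one-dimensional. -/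
lemma eq_trace_smul_of_schrodingerMap_eq_zero (hK : K + Kᴴ + ∑ d, (V d)ᴴ * V d = 0)
    {ρ : Matrix n n ℂ}
    (huniq : ∀ σ : Matrix n n ℂ, σ.PosSemidef → σ.trace = 1 → schrodingerMap K V σ = 0 → σ = ρ)
    {X : Matrix n n ℂ} (h : schrodingerMap K V X = 0) : X = X.trace • ρ := by
  have hpos : ∀ Y : Matrix n n ℂ, Y.PosSemidef → schrodingerMap K V Y = 0 →
      Y = Y.trace • ρ := by
    intro Y hY hLY
    by_cases ht : Y.trace = 0
    · rw [ht, zero_smul, hY.trace_eq_zero_iff.mp ht]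
    · have := huniq (Y.trace⁻¹ • Y) (hY.smul (inv_nonneg.mpr hY.trace_nonneg))
        (by rw [trace_smul, smul_eq_mul, inv_mul_cancel₀ ht]) (by rw [map_smul, hLY, smul_zero])
      rw [← this, smul_smul, mul_inv_cancel₀ ht, one_smul]
  have hherm : ∀ S : Matrix n n ℂ, S.IsHermitian → schrodingerMap K V S = 0 →
      S = S.trace • ρ := by
    intro S hS hLS
    obtain ⟨Y, Z, hY, hZ, hLY, hLZ, rfl⟩ :=
      exists_posSemidef_decomposition_of_schrodingerMap_eq_zero hK hS hLS
    rw [trace_sub, sub_smul, ← hpos Y hY hLY, ← hpos Z hZ hLZ]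
  obtain ⟨S, T, hS, hT, hX, hS', hT'⟩ := exists_isHermitian_add_I_smul X
  have hLS : schrodingerMap K V S = 0 := by
    rw [hS', map_smul, map_add, schrodingerMap_conjTranspose, h]; simp
  have hLT : schrodingerMap K V T = 0 := by
    rw [hT', map_smul, map_sub, schrodingerMap_conjTranspose, h]; simp
  rw [hX, trace_add, trace_smul, add_smul, smul_assoc, ← hherm S hS hLS, ← hherm T hT hLT]

lemma surjective_shiftedMap (hK : K + Kᴴ + ∑ d, (V d)ᴴ * V d = 0) {ρ : Matrix n n ℂ}
    (hρ : ρ.trace = 1)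
    (hker : ∀ X : Matrix n n ℂ, schrodingerMap K V X = 0 → X = X.trace • ρ) :
    Function.Surjective (shiftedMap K V ρ) := by
  rw [← LinearMap.injective_iff_surjective, ← LinearMap.ker_eq_bot, LinearMap.ker_eq_bot']
  intro X hX
  rw [shiftedMap_apply] at hX
  have ht : X.trace = 0 := by
    have := congrArg trace hX
    rw [trace_sub, trace_schrodingerMap hK, trace_smul, hρ] at this
    simpa using this
  rw [ht, zero_smul, sub_zero] at hX
  rw [hker X hX, ht, zero_smul]

/-- The range of `L*` is the annihilator of `ker L = ℂ ρ`. -/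
lemma exists_heisenbergMap_eq (hK : K + Kᴴ + ∑ d, (V d)ᴴ * V d = 0) {ρ : Matrix n n ℂ}
    (hρ : ρ.trace = 1) (hLρ : schrodingerMap K V ρ = 0)
    (hker : ∀ X : Matrix n n ℂ, schrodingerMap K V X = 0 → X = X.trace • ρ)
    {Z : Matrix n n ℂ} (hZ : Z.IsHermitian) (hρZ : (ρ * Z).trace = 0) :
    ∃ Y : Matrix n n ℂ, Y.IsHermitian ∧ heisenbergMap K V Y = Z := by
  -- the trace adjoint of `shiftedMap`
  let G : Matrix n n ℂ →ₗ[ℂ] Matrix n n ℂ := heisenbergMap K V -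
    ((traceLinearMap n ℂ ℂ) ∘ₗ LinearMap.mulLeft ℂ ρ).smulRight 1
  have hG : ∀ A, G A = heisenbergMap K V A - (ρ * A).trace • 1 := fun A => rfl
  have hadj : ∀ A X, (A * shiftedMap K V ρ X).trace = (G A * X).trace := by
    intro A X
    rw [shiftedMap_apply, hG, Matrix.mul_sub, Matrix.sub_mul, trace_sub, trace_sub,
      trace_mul_schrodingerMap, Matrix.mul_smul, Matrix.smul_mul, trace_smul, trace_smul,
      Matrix.one_mul, trace_mul_comm A ρ, smul_eq_mul, smul_eq_mul, mul_comm]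
  obtain ⟨Y, hY⟩ := surjective_of_trace_adjoint hadj (surjective_shiftedMap hK hρ hker) Z
  rw [hG] at hY
  have hρY : (ρ * Y).trace = 0 := by
    have := congrArg (fun M => (M * ρ).trace) hY
    simp only [Matrix.sub_mul, trace_sub, ← trace_mul_schrodingerMap, hLρ] at this
    rw [trace_mul_comm Z, hρZ] at this
    simpa [hρ] using this
  rw [hρY, zero_smul, sub_zero] at hY
  refine ⟨(1 / 2 : ℂ) • (Y + Yᴴ), by simp [IsHermitian, add_comm], ?_⟩
  rw [map_smul, map_add, heisenbergMap_conjTranspose, hY, hZ.eq, ← two_smul ℂ Z, smul_smul]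
  norm_num

/-- Subharmonic observables attain their maximum on the unique steady state. With `Z = L* Y` and
`Y ≤ y`, the maximum principle bounds `Z` by `c (y - Y)` for every `c > 0`. -/
lemma neg_posSemidef_of_subharmonic (hK : K + Kᴴ + ∑ d, (V d)ᴴ * V d = 0) {ρ : Matrix n n ℂ}
    (hρ : ρ.trace = 1) (hLρ : schrodingerMap K V ρ = 0)
    (hker : ∀ X : Matrix n n ℂ, schrodingerMap K V X = 0 → X = X.trace • ρ)
    {Z : Matrix n n ℂ} (hZ : Z.IsHermitian) (hρZ : (ρ * Z).trace = 0)
    (hLZ : (heisenbergMap K V Z).PosSemidef) : (-Z).PosSemidef := by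
  cases isEmpty_or_nonempty n
  · rw [Subsingleton.elim (-Z) 0]; exact .zero
  obtain ⟨Y, hY, hLY⟩ := exists_heisenbergMap_eq hK hρ hLρ hker hZ hρZ
  -- `B = y - Y` with the upper bound `y = -r` of `Y`
  obtain ⟨r, -, -, -, hr⟩ := hY.neg.exists_least_eigenvalue
  set B := -Y - (r : ℂ) • (1 : Matrix n n ℂ) with hB
  have hLB : heisenbergMap K V B = -Z := by
    rw [hB, map_sub, map_neg, map_smul, heisenbergMap_one hK, hLY]; simp
  have hbound : ∀ c : ℝ, 0 < c → ((c : ℂ) • B + -Z).PosSemidef := by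
    intro c hc
    have hcc : (0 : ℂ) ≤ c := Complex.zero_le_real.mpr hc.le
    refine posSemidef_of_smul_sub_heisenbergMap hK ((hr.smul hcc).1.add hZ.neg) hc ?_
    have : (c : ℂ) • ((c : ℂ) • B + -Z) - heisenbergMap K V ((c : ℂ) • B + -Z)
        = (c : ℂ) • (c : ℂ) • B + heisenbergMap K V Z := by
      rw [map_add, map_smul, map_neg, hLB, smul_add]; abel
    rw [this]
    exact ((hr.smul hcc).smul hcc).add hLZ
  refine hZ.neg.posSemidef_of_trace_mul_vecMulVec_nonneg fun v => ?_
  set W := vecMulVec v (star v)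
  have hW : W.PosSemidef := posSemidef_vecMulVec_self_star v
  have hev : ∀ᶠ c : ℝ in 𝓝[>] 0, 0 ≤ (c : ℂ) * (B * W).trace + (-Z * W).trace := by
    filter_upwards [self_mem_nhdsWithin] with c hc
    have := (hbound c hc).trace_mul_nonneg hW
    rwa [Matrix.add_mul, trace_add, Matrix.smul_mul, trace_smul, smul_eq_mul] at this
  have hlim : Tendsto (fun c : ℝ => (c : ℂ) * (B * W).trace + (-Z * W).trace) (𝓝[>] 0)
      (𝓝 ((-Z * W).trace)) := by
    have : Continuous fun c : ℝ => (c : ℂ) * (B * W).trace + (-Z * W).trace := by fun_prop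
    simpa using (this.tendsto 0).mono_left nhdsWithin_le_nhds
  exact ge_of_tendsto hlim hev

end SteadyStates

/-! ### Eigenvalues of the generator -/

section Eigenvalues

variable {n κ : Type*} [Fintype n] [Fintype κ]
variable {K : Matrix n n ℂ} {V : κ → Matrix n n ℂ}

/-- The dissipation identity: `L*(X†X)` exceeds the Leibniz expression by a positive term, the
sum of the squared commutators of `X` with the jump operators. -/
lemma heisenbergMap_conjTranspose_mul_self (hK : K + Kᴴ + ∑ d, (V d)ᴴ * V d = 0)
    (X : Matrix n n ℂ) :
    heisenbergMap K V (Xᴴ * X) = (heisenbergMap K V X)ᴴ * X + Xᴴ * heisenbergMap K V X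
      + ∑ d, (V d * X - X * V d)ᴴ * (V d * X - X * V d) := by
  have hV : ∑ d, (V d)ᴴ * V d = -(K + Kᴴ) := by rw [eq_neg_iff_add_eq_zero, add_comm, hK]
  have hsum : ∑ d, (V d * X - X * V d)ᴴ * (V d * X - X * V d)
      = Xᴴ * (∑ d, (V d)ᴴ * V d) * X - Xᴴ * (∑ d, (V d)ᴴ * X * V d)
        - (∑ d, (V d)ᴴ * Xᴴ * V d) * X + ∑ d, (V d)ᴴ * (Xᴴ * X) * V d := by
    simp only [Matrix.mul_sum, Matrix.sum_mul, ← Finset.sum_sub_distrib, ← Finset.sum_add_distrib]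
    refine Finset.sum_congr rfl fun d _ => ?_
    simp only [conjTranspose_sub, conjTranspose_mul]
    noncomm_ring
  rw [hsum, hV, ← heisenbergMap_conjTranspose]
  simp only [heisenbergMap_apply]
  noncomm_ring

variable [DecidableEq n]

/-- For an eigenoperator `L* X = z X` with `0 ≤ re z`, the observable `X†X` is subharmonic, hence
at most its expectation `s` in the unique steady state `ρ`. This forces `re z = 0`, `X†X ρ = s ρ`
and `V X ρ = X V ρ` for the jump operators, so that `X ρ X†` is again stationary and thus equals
`s ρ`. Comparing the traces of `K X ρ X†` and `s K ρ` gives `z = 0`. -/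
lemma eq_zero_of_heisenbergMap_eq_smul (hK : K + Kᴴ + ∑ d, (V d)ᴴ * V d = 0)
    {ρ : Matrix n n ℂ} (hρpos : ρ.PosSemidef) (hρ : ρ.trace = 1)
    (hLρ : schrodingerMap K V ρ = 0)
    (hker : ∀ X : Matrix n n ℂ, schrodingerMap K V X = 0 → X = X.trace • ρ)
    {X : Matrix n n ℂ} (hX : X ≠ 0) {z : ℂ} (hz : 0 ≤ z.re)
    (h : heisenbergMap K V X = z • X) : z = 0 := by
  set Z := Xᴴ * X with hZdef
  have hZ : Z.PosSemidef := posSemidef_conjTranspose_mul_self X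
  set C : κ → Matrix n n ℂ := fun d => V d * X - X * V d with hC
  have hCpos : ∀ d, ((C d)ᴴ * C d).PosSemidef := fun d => posSemidef_conjTranspose_mul_self _
  have hDpos : (∑ d, (C d)ᴴ * C d).PosSemidef := posSemidef_sum _ fun d _ => hCpos d
  have hzz : star z + z = ((2 * z.re : ℝ) : ℂ) := by
    rw [add_comm]; exact Complex.add_conj z
  have hzr : (0 : ℂ) ≤ ((2 * z.re : ℝ) : ℂ) := Complex.zero_le_real.mpr (by positivity)
  have hLZ : heisenbergMap K V Z = ((2 * z.re : ℝ) : ℂ) • Z + ∑ d, (C d)ᴴ * C d := by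
    rw [hZdef, heisenbergMap_conjTranspose_mul_self hK, h, conjTranspose_smul, Matrix.smul_mul,
      Matrix.mul_smul, ← add_smul, hzz]
  set s := (ρ * Z).trace with hs
  have hs0 : 0 ≤ s := hρpos.trace_mul_nonneg hZ
  have hsstar : star s = s := (IsSelfAdjoint.of_nonneg hs0).star_eq
  -- stationarity of `ρ`: the two nonnegative terms of `Tr (ρ L* Z)` cancel, so both vanish
  have hbal : ((2 * z.re : ℝ) : ℂ) * s + (ρ * ∑ d, (C d)ᴴ * C d).trace = 0 := by
    have : (heisenbergMap K V Z * ρ).trace = 0 := by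
      rw [← trace_mul_schrodingerMap, hLρ]; simp
    rwa [trace_mul_comm, hLZ, Matrix.mul_add, trace_add, Matrix.mul_smul, trace_smul,
      smul_eq_mul] at this
  obtain ⟨hb1, hb2⟩ := (add_eq_zero_iff_of_nonneg (mul_nonneg hzr hs0)
    (hρpos.trace_mul_nonneg hDpos)).mp hbal
  have hsZ : (-(Z - s • (1 : Matrix n n ℂ))).PosSemidef := by
    refine neg_posSemidef_of_subharmonic hK hρ hLρ hker ?_ ?_ ?_
    · refine hZ.1.sub ?_
      rw [IsHermitian, conjTranspose_smul, hsstar, conjTranspose_one]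
    · rw [Matrix.mul_sub, trace_sub, Matrix.mul_smul, Matrix.mul_one, trace_smul, hρ, ← hs]
      simp
    · rw [map_sub, map_smul, heisenbergMap_one hK, smul_zero, sub_zero, hLZ]
      exact (hZ.smul hzr).add hDpos
  have hρZ : ρ * Z = s • ρ := by
    have := hρpos.mul_eq_zero_of_trace_mul_eq_zero hsZ (by
      rw [neg_sub, Matrix.mul_sub, trace_sub, Matrix.mul_smul, Matrix.mul_one, trace_smul, hρ,
        ← hs]
      simp)
    rw [neg_sub, Matrix.mul_sub, Matrix.mul_smul, Matrix.mul_one, sub_eq_zero] at this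
    exact this.symm
  have hs_ne : s ≠ 0 := by
    intro hs'
    rw [hs', zero_smul, sub_zero] at hsZ
    have h1 := hsZ.trace_nonneg
    rw [trace_neg, neg_nonneg] at h1
    have h2 : Z.trace = 0 := le_antisymm h1 hZ.trace_nonneg
    exact hX (trace_conjTranspose_mul_self_eq_zero_iff.mp h2)
  have hre : star z + z = 0 := by
    rw [hzz]; exact (mul_eq_zero.mp hb1).resolve_right hs_ne
  have hcomm : ∀ d, V d * X * ρ = X * V d * ρ := by
    intro d
    rw [Matrix.mul_sum, trace_sum] at hb2
    have h1 := (Finset.sum_eq_zero_iff_of_nonneg fun d _ =>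
      hρpos.trace_mul_nonneg (hCpos d)).mp hb2 d (Finset.mem_univ d)
    have h2 := hρpos.mul_eq_zero_of_trace_mul_eq_zero (hCpos d) h1
    have h3 : C d * ρ = 0 := by
      rw [← trace_conjTranspose_mul_self_eq_zero_iff, conjTranspose_mul, hρpos.1.eq,
        Matrix.mul_assoc, ← Matrix.mul_assoc (C d)ᴴ, ← Matrix.mul_assoc, h2, Matrix.zero_mul,
        trace_zero]
    rwa [hC, Matrix.sub_mul, sub_eq_zero] at h3
  have hKX : K * X * ρ = X * K * ρ - z • (X * ρ) := by
    have h1 := congrArg (· * ρ) h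
    simp only [heisenbergMap_apply, Matrix.add_mul, Matrix.sum_mul, Matrix.smul_mul] at h1
    have h2 : ∑ d, (V d)ᴴ * X * V d * ρ = -((K + Kᴴ) * (X * ρ)) := by
      rw [← Matrix.neg_mul, show -(K + Kᴴ) = ∑ d, (V d)ᴴ * V d by
        rw [neg_eq_iff_add_eq_zero, hK], Matrix.sum_mul]
      refine Finset.sum_congr rfl fun d _ => ?_
      rw [Matrix.mul_assoc (_ᴴ), Matrix.mul_assoc (_ᴴ), ← hcomm d]
      simp only [Matrix.mul_assoc]
    rw [h2] at h1
    rw [← h1]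
    noncomm_ring
  have hKX' : ρ * Xᴴ * Kᴴ = ρ * Kᴴ * Xᴴ - star z • (ρ * Xᴴ) := by
    have := congrArg conjTranspose hKX
    simpa only [conjTranspose_mul, conjTranspose_sub, conjTranspose_smul, hρpos.1.eq,
      ← Matrix.mul_assoc] using this
  have hcomm' : ∀ d, ρ * Xᴴ * (V d)ᴴ = ρ * (V d)ᴴ * Xᴴ := by
    intro d
    have := congrArg conjTranspose (hcomm d)
    simpa only [conjTranspose_mul, hρpos.1.eq, ← Matrix.mul_assoc] using this
  have hLρ' : schrodingerMap K V (X * ρ * Xᴴ) = 0 := by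
    have hjump : ∀ d, V d * (X * ρ * Xᴴ) * (V d)ᴴ = X * (V d * ρ * (V d)ᴴ) * Xᴴ := by
      intro d
      calc V d * (X * ρ * Xᴴ) * (V d)ᴴ = V d * X * ρ * Xᴴ * (V d)ᴴ := by
            simp only [Matrix.mul_assoc]
        _ = X * V d * (ρ * Xᴴ * (V d)ᴴ) := by rw [hcomm d]; simp only [Matrix.mul_assoc]
        _ = _ := by rw [hcomm' d]; simp only [Matrix.mul_assoc]
    have h1 : K * (X * ρ * Xᴴ) = X * (K * ρ) * Xᴴ - z • (X * ρ * Xᴴ) := by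
      rw [← Matrix.mul_assoc, ← Matrix.mul_assoc, hKX, Matrix.sub_mul, Matrix.smul_mul]
      simp only [Matrix.mul_assoc]
    have h2 : X * ρ * Xᴴ * Kᴴ = X * (ρ * Kᴴ) * Xᴴ - star z • (X * ρ * Xᴴ) := by
      rw [Matrix.mul_assoc X, Matrix.mul_assoc X, hKX', Matrix.mul_sub, Matrix.mul_smul]
      simp only [Matrix.mul_assoc]
    rw [schrodingerMap_apply, h1, h2, Finset.sum_congr rfl fun d _ => hjump d, ← Matrix.sum_mul,
      ← Matrix.mul_sum]
    have h3 : X * (schrodingerMap K V ρ) * Xᴴ - (star z + z) • (X * ρ * Xᴴ) = 0 := by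
      rw [hLρ, hre]; simp
    rw [schrodingerMap_apply, Matrix.mul_add, Matrix.mul_add, Matrix.add_mul, Matrix.add_mul,
      add_smul] at h3
    rw [← h3]; abel
  have htr : (X * ρ * Xᴴ).trace = s := by
    rw [trace_mul_comm, ← Matrix.mul_assoc, trace_mul_comm]
  have hρ' : X * ρ * Xᴴ = s • ρ := by
    rw [← htr]; exact hker _ hLρ'
  have hfin : s * (K * ρ).trace = s * (K * ρ).trace - z * s := by
    calc s * (K * ρ).trace = (K * X * ρ * Xᴴ).trace := by
          rw [Matrix.mul_assoc, Matrix.mul_assoc, ← Matrix.mul_assoc X, hρ', Matrix.mul_smul,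
            trace_smul, smul_eq_mul]
      _ = (X * K * ρ * Xᴴ).trace - z * s := by
          rw [hKX, Matrix.sub_mul, Matrix.smul_mul, trace_sub, trace_smul, htr, smul_eq_mul]
      _ = (ρ * Z * K).trace - z * s := by
          rw [trace_mul_comm (X * K * ρ), Matrix.mul_assoc X, ← Matrix.mul_assoc Xᴴ,
            trace_mul_comm (Xᴴ * X), Matrix.mul_assoc K, trace_mul_comm K]
      _ = s * (K * ρ).trace - z * s := by
          rw [hρZ, Matrix.smul_mul, trace_smul, smul_eq_mul, trace_mul_comm ρ K]
  have : z * s = 0 := by linear_combination hfin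
  exact (mul_eq_zero.mp this).resolve_right hs_ne

/-- On traceless matrices the spectrum of the generator lies in the open left half-plane. -/
theorem re_neg_of_schrodingerMap_eq_smul (hK : K + Kᴴ + ∑ d, (V d)ᴴ * V d = 0)
    {ρ : Matrix n n ℂ} (hρpos : ρ.PosSemidef) (hρ : ρ.trace = 1)
    (hLρ : schrodingerMap K V ρ = 0)
    (huniq : ∀ σ : Matrix n n ℂ, σ.PosSemidef → σ.trace = 1 → schrodingerMap K V σ = 0 → σ = ρ)
    {X : Matrix n n ℂ} (hX : X ≠ 0) (hXtr : X.trace = 0) {z : ℂ}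
    (h : schrodingerMap K V X = z • X) : z.re < 0 := by
  by_contra! hz
  have hker := fun X : Matrix n n ℂ => eq_trace_smul_of_schrodingerMap_eq_zero hK huniq (X := X)
  have hz0 : z = 0 := by
    by_contra hz0
    have hinj : Function.Injective
        (heisenbergMap K V - z • (LinearMap.id : Matrix n n ℂ →ₗ[ℂ] Matrix n n ℂ)) := by
      rw [← LinearMap.ker_eq_bot, LinearMap.ker_eq_bot']
      intro A hA
      by_contra hA0
      exact hz0 (eq_zero_of_heisenbergMap_eq_smul hK hρpos hρ hLρ hker hA0 hz (sub_eq_zero.mp hA))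
    have hsurj := surjective_of_trace_adjoint
      (G := schrodingerMap K V - z • (LinearMap.id : Matrix n n ℂ →ₗ[ℂ] Matrix n n ℂ))
      (fun A X => by
        simp only [LinearMap.sub_apply, LinearMap.smul_apply, LinearMap.id_apply, Matrix.mul_sub,
          Matrix.sub_mul, trace_sub, Matrix.mul_smul, Matrix.smul_mul]
        rw [trace_mul_comm A (heisenbergMap K V X), ← trace_mul_schrodingerMap, trace_mul_comm X])
      (LinearMap.injective_iff_surjective.mp hinj)
    exact hX (LinearMap.injective_iff_surjective.mpr hsurj (by simp [h]))
  rw [hz0, zero_smul] at h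
  exact hX (by rw [hker X h, hXtr, zero_smul])

/-- The spectrum of the shifted generator lies in the open left half-plane. -/
lemma re_neg_of_shiftedMap_eq_smul (hK : K + Kᴴ + ∑ d, (V d)ᴴ * V d = 0)
    {ρ : Matrix n n ℂ} (hρpos : ρ.PosSemidef) (hρ : ρ.trace = 1)
    (hLρ : schrodingerMap K V ρ = 0)
    (huniq : ∀ σ : Matrix n n ℂ, σ.PosSemidef → σ.trace = 1 → schrodingerMap K V σ = 0 → σ = ρ)
    {X : Matrix n n ℂ} (hX : X ≠ 0) {z : ℂ} (h : shiftedMap K V ρ X = z • X) : z.re < 0 := by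
  rw [shiftedMap_apply] at h
  have htr := congrArg trace h
  rw [trace_sub, trace_schrodingerMap hK, trace_smul, trace_smul, hρ, smul_eq_mul, smul_eq_mul,
    mul_one, zero_sub] at htr
  have hz : (z + 1) * X.trace = 0 := by linear_combination -htr
  rcases mul_eq_zero.mp hz with hz | ht
  · rw [eq_neg_of_add_eq_zero_left hz]; simp
  · rw [ht, zero_smul, sub_zero] at h
    exact re_neg_of_schrodingerMap_eq_smul hK hρpos hρ hLρ huniq hX ht h

end Eigenvalues

/-! ### Stability of linear differential equations -/

section Stability

variable {E : Type*} [NormedAddCommGroup E] [NormedSpace ℂ E]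

lemma exp_apply_of_eigenvector [CompleteSpace E] {L : E →L[ℂ] E} {v : E} {z : ℂ}
    (h : L v = z • v) : NormedSpace.exp L v = Complex.exp z • v := by
  have hpow : ∀ k : ℕ, (L ^ k) v = z ^ k • v := by
    intro k
    induction k with
    | zero => simp
    | succ k ih => rw [pow_succ', mul_apply_eq_comp, ih, map_smul, h, smul_smul, pow_succ]
  have h1 := ((NormedSpace.exp_series_hasSum_exp' (𝕂 := ℂ) L).mapL
    (ContinuousLinearMap.apply ℂ E v))
  have h2 := (NormedSpace.exp_series_hasSum_exp' (𝕂 := ℂ) z).smul_const v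
  rw [← Complex.exp_eq_exp_ℂ] at h2
  refine h1.unique ?_
  convert h2 using 2 with k
  simp [hpow, smul_smul]

variable [FiniteDimensional ℂ E]

/-- An eigenvalue of `exp L` comes from an eigenvector of `L`, found in the corresponding
`L`-invariant eigenspace. -/
lemma exists_eigenvector_of_mem_spectrum_exp {L : E →L[ℂ] E} {μ : ℂ}
    (hμ : μ ∈ spectrum ℂ (NormedSpace.exp L)) :
    ∃ (z : ℂ) (v : E), v ≠ 0 ∧ L v = z • v ∧ μ = Complex.exp z := by
  have : CompleteSpace E := FiniteDimensional.complete ℂ E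
  set T := NormedSpace.exp L with hT
  have hLT : ∀ x, L (T x) = T (L x) := fun x =>
    congrArg (· x) (((Commute.refl L).exp_right).eq : L * T = T * L)
  have hev : Module.End.HasEigenvalue (T : E →ₗ[ℂ] E) μ := by
    rw [Module.End.hasEigenvalue_iff_mem_spectrum, spectrum.mem_iff]
    intro hu
    refine spectrum.mem_iff.mp hμ ?_
    rw [Module.End.isUnit_iff] at hu
    rw [ContinuousLinearMap.isUnit_iff_bijective]
    exact hu
  let W := Module.End.eigenspace (T : E →ₗ[ℂ] E) μ
  have hW : ∀ x ∈ W, (L : E →ₗ[ℂ] E) x ∈ W := by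
    intro x hx
    rw [Module.End.mem_eigenspace_iff] at hx ⊢
    simp only [ContinuousLinearMap.coe_coe] at hx ⊢
    rw [← hLT, hx, map_smul]
  have : Nontrivial W := Submodule.nontrivial_iff_ne_bot.mpr hev
  obtain ⟨z, hz⟩ := Module.End.exists_eigenvalue ((L : E →ₗ[ℂ] E).restrict hW)
  obtain ⟨v, hv⟩ := hz.exists_hasEigenvector
  have hv0 : (v : E) ≠ 0 := fun h => hv.2 (Subtype.ext h)
  have hLv : L v = z • (v : E) := congrArg Subtype.val hv.apply_eq_smul
  refine ⟨z, v, hv0, hLv, ?_⟩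
  have h1 : T v = μ • (v : E) := Module.End.mem_eigenspace_iff.mp v.2
  rw [hT, exp_apply_of_eigenvector hLv] at h1
  exact (smul_left_injective ℂ hv0 h1).symm

/-- Powers of an operator of spectral radius less than one tend to zero, by Gelfand's formula. -/
lemma tendsto_pow_zero_of_spectralRadius_lt_one {A : Type*} [NormedRing A] [NormedAlgebra ℂ A]
    [CompleteSpace A] {a : A} (h : spectralRadius ℂ a < 1) :
    Tendsto (fun k : ℕ => a ^ k) atTop (𝓝 0) := by
  obtain ⟨r, hr, hr1⟩ := ENNReal.lt_iff_exists_nnreal_btwn.mp h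
  have hr1' : r < 1 := by exact_mod_cast hr1
  have hev := (spectrum.pow_nnnorm_pow_one_div_tendsto_nhds_spectralRadius a).eventually_lt_const hr
  refine squeeze_zero_norm' ?_ (tendsto_pow_atTop_nhds_zero_of_lt_one r.coe_nonneg
    (NNReal.coe_lt_one.mpr hr1'))
  filter_upwards [hev, eventually_gt_atTop 0] with k hk hk0
  have hk0' : (0 : ℝ) < k := Nat.cast_pos.mpr hk0
  have h1 : (‖a ^ k‖₊ : ENNReal) ≤ (r : ENNReal) ^ k := by
    have := ENNReal.rpow_le_rpow hk.le hk0'.le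
    rwa [← ENNReal.rpow_mul, one_div, inv_mul_cancel₀ hk0'.ne', ENNReal.rpow_one,
      ENNReal.rpow_natCast] at this
  have h2 : ‖a ^ k‖₊ ≤ r ^ k := by exact_mod_cast h1
  exact_mod_cast h2

lemma tendsto_exp_smul_zero {L : E →L[ℂ] E}
    (hL : ∀ (z : ℂ) (v : E), v ≠ 0 → L v = z • v → z.re < 0) :
    Tendsto (fun t : ℝ => NormedSpace.exp (t • L)) atTop (𝓝 0) := by
  have : CompleteSpace E := FiniteDimensional.complete ℂ E
  let : NormedAlgebra ℚ (E →L[ℂ] E) := NormedAlgebra.restrictScalars ℚ ℂ _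
  cases subsingleton_or_nontrivial E
  · exact tendsto_const_nhds.congr fun t => Subsingleton.elim _ _
  have hrad : spectralRadius ℂ (NormedSpace.exp L) < 1 := by
    refine spectrum.spectralRadius_lt_of_forall_lt (NormedSpace.exp L) (r := 1) fun μ hμ => ?_
    obtain ⟨z, v, hv, hLv, rfl⟩ := exists_eigenvector_of_mem_spectrum_exp hμ
    rw [← NNReal.coe_lt_coe, coe_nnnorm, Complex.norm_exp, NNReal.coe_one, Real.exp_lt_one_iff]
    exact hL z v hv hLv
  have hpow := tendsto_pow_zero_of_spectralRadius_lt_one hrad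
  -- bound `exp (sL)` on the compact interval `[0, 1]`
  obtain ⟨C, hC⟩ := (isCompact_Icc (a := (0 : ℝ)) (b := 1)).exists_bound_of_continuousOn
    (f := fun s : ℝ => NormedSpace.exp (s • L))
    (NormedSpace.exp_continuous.comp (by fun_prop)).continuousOn
  have hfloor : Tendsto (fun t : ℝ => C * ‖NormedSpace.exp L ^ ⌊t⌋₊‖) atTop (𝓝 0) := by
    simpa using ((hpow.comp tendsto_nat_floor_atTop).norm).const_mul C
  refine squeeze_zero_norm' ?_ hfloor
  filter_upwards [eventually_ge_atTop (0 : ℝ)] with t ht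
  -- split off the integer part of `t`
  have hsplit : NormedSpace.exp (t • L)
      = NormedSpace.exp ((t - ⌊t⌋₊) • L) * NormedSpace.exp L ^ ⌊t⌋₊ := by
    rw [← NormedSpace.exp_nsmul, ← Nat.cast_smul_eq_nsmul ℝ,
      ← NormedSpace.exp_add_of_commute, ← add_smul, sub_add_cancel]
    exact ((Commute.refl L).smul_left _).smul_right _
  rw [hsplit]
  refine (norm_mul_le _ _).trans (mul_le_mul_of_nonneg_right (hC _ ⟨?_, ?_⟩) (norm_nonneg _))
  · exact sub_nonneg.mpr (Nat.floor_le ht)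
  · linarith [Nat.lt_floor_add_one t]

/-- Solutions of `x' = L x` on `[0, ∞)` tend to zero when the spectrum of `L` lies in the open
left half-plane. -/
theorem tendsto_zero_of_hasDerivWithinAt {L : E →L[ℂ] E}
    (hL : ∀ (z : ℂ) (v : E), v ≠ 0 → L v = z • v → z.re < 0) {x : ℝ → E}
    (hx : ∀ t : ℝ, 0 ≤ t → HasDerivWithinAt x (L (x t)) (Ici 0) t) :
    Tendsto x atTop (𝓝 0) := by
  have : CompleteSpace E := FiniteDimensional.complete ℂ E
  have hy : ∀ t : ℝ, HasDerivAt (fun s : ℝ => NormedSpace.exp (s • L) (x 0))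
      (L (NormedSpace.exp (t • L) (x 0))) t := by
    intro t
    have h1 := hasDerivAt_exp_smul_const' (𝕂 := ℝ) L t
    exact (((ContinuousLinearMap.apply ℂ E (x 0)).restrictScalars ℝ).hasFDerivAt.comp_hasDerivAt
      t h1)
  have heq : ∀ t : ℝ, 0 ≤ t → x t = NormedSpace.exp (t • L) (x 0) := by
    intro t ht
    refine ODE_solution_unique_of_mem_Icc_right (f := x)
      (g := fun s : ℝ => NormedSpace.exp (s • L) (x 0)) (v := fun _ => L) (s := fun _ => univ)
      (K := ‖L‖₊) (a := 0) (b := t) (fun _ _ => L.lipschitz.lipschitzOnWith) ?_ ?_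
      (fun _ _ => mem_univ _) ?_ ?_ (fun _ _ => mem_univ _) ?_ ⟨ht, le_rfl⟩
    · exact fun s hs => (hx s hs.1).continuousWithinAt.mono Icc_subset_Ici_self
    · exact fun s hs => (hx s hs.1).mono (Ici_subset_Ici.mpr hs.1)
    · exact fun s _ => (hy s).continuousAt.continuousWithinAt
    · exact fun s _ => (hy s).hasDerivWithinAt
    · simp
  have hlim : Tendsto (fun t : ℝ => NormedSpace.exp (t • L) (x 0)) atTop (𝓝 0) := by
    have := ((ContinuousLinearMap.apply ℂ E (x 0)).continuous.tendsto 0).comp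
      (tendsto_exp_smul_zero hL)
    rwa [map_zero] at this
  refine hlim.congr' ?_
  filter_upwards [eventually_ge_atTop (0 : ℝ)] with t ht using (heq t ht).symm

end Stability

/-! ### Attractivity -/

section MasterEquation

variable {N : ℕ} {ι : Type*} [Fintype ι] {H : Matrix (Fin N) (Fin N) ℂ}
  {V : ι → Matrix (Fin N) (Fin N) ℂ}

/-- The effective non-Hermitian Hamiltonian (times `-i`): `K = -iH - ½ ∑ V†V`. -/
noncomputable def effectiveOperator (H : Matrix (Fin N) (Fin N) ℂ)
    (V : ι → Matrix (Fin N) (Fin N) ℂ) :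
    Matrix (Fin N) (Fin N) ℂ :=
  (-Complex.I) • H - (1 / 2 : ℂ) • ∑ d, (V d)ᴴ * V d

lemma effectiveOperator_conjTranspose (hH : H.IsHermitian) :
    (effectiveOperator H V)ᴴ = Complex.I • H - (1 / 2 : ℂ) • ∑ d, (V d)ᴴ * V d := by
  simp [effectiveOperator, conjTranspose_sum, hH.eq]

lemma effectiveOperator_add_conjTranspose (hH : H.IsHermitian) :
    effectiveOperator H V + (effectiveOperator H V)ᴴ + ∑ d, (V d)ᴴ * V d = 0 := by
  rw [effectiveOperator_conjTranspose hH, effectiveOperator]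
  module

lemma generator_eq_schrodingerMap (hH : H.IsHermitian) (ρ : Matrix (Fin N) (Fin N) ℂ) :
    generator H V ρ = schrodingerMap (effectiveOperator H V) V ρ := by
  rw [schrodingerMap_apply, effectiveOperator_conjTranspose hH, effectiveOperator, generator]
  simp only [dissipator, Finset.sum_sub_distrib, ← Finset.smul_sum, Finset.sum_add_distrib,
    ← Matrix.sum_mul, ← Matrix.mul_sum, Matrix.sub_mul, Matrix.mul_sub, Matrix.smul_mul,
    Matrix.mul_smul]
  module

/-- Uniqueness among steady states, restated for `schrodingerMap`. -/
lemma eq_of_schrodingerMap_eq_zero (hH : H.IsHermitian) {ρss : Matrix (Fin N) (Fin N) ℂ}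
    (huniq : ∀ ρ : Matrix (Fin N) (Fin N) ℂ, IsSteadyState H V ρ → ρ = ρss)
    (σ : Matrix (Fin N) (Fin N) ℂ) (hσ : σ.PosSemidef) (htr : σ.trace = 1)
    (h : schrodingerMap (effectiveOperator H V) V σ = 0) : σ = ρss :=
  huniq σ ⟨⟨hσ, htr⟩, by rw [generator_eq_schrodingerMap hH, h]⟩

lemma IsAttractive.eq_of_isSteadyState {ρss ρ : Matrix (Fin N) (Fin N) ℂ}
    (h : IsAttractive H V ρss) (hρ : IsSteadyState H V ρ) : ρ = ρss := by
  refine tendsto_nhds_unique tendsto_const_nhds (h (fun _ => ρ) ⟨hρ.1, fun t _ i j => ?_⟩)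
  rw [hρ.2]
  exact hasDerivWithinAt_const _ _ _

lemma IsSolution.hasDerivWithinAt_trace (hH : H.IsHermitian) {ρ : ℝ → Matrix (Fin N) (Fin N) ℂ}
    (h : IsSolution H V ρ) {t : ℝ} (ht : 0 ≤ t) :
    HasDerivWithinAt (fun s => (ρ s).trace) 0 (Ici 0) t := by
  have h1 := HasDerivWithinAt.fun_sum (u := Finset.univ) fun i _ => h.evolution t ht i i
  have h2 : ∑ i, generator H V (ρ t) i i = 0 := by
    rw [generator_eq_schrodingerMap hH]
    exact trace_schrodingerMap (effectiveOperator_add_conjTranspose hH) (ρ t)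
  rwa [h2] at h1

lemma IsSolution.trace_eq_one (hH : H.IsHermitian) {ρ : ℝ → Matrix (Fin N) (Fin N) ℂ}
    (h : IsSolution H V ρ) {t : ℝ} (ht : 0 ≤ t) : (ρ t).trace = 1 := by
  have h0 : ∀ s, 0 ≤ s → HasDerivWithinAt (fun s => (ρ s).trace) 0 (Ici 0) s :=
    fun s hs => h.hasDerivWithinAt_trace hH hs
  rw [← h.initial.2]
  exact constant_of_has_deriv_right_zero (f := fun s => (ρ s).trace) (a := 0) (b := t)
    (fun s hs => (h0 s hs.1).continuousWithinAt.mono Icc_subset_Ici_self)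
    (fun s hs => (h0 s hs.1).mono (Ici_subset_Ici.mpr hs.1)) t ⟨ht, le_rfl⟩

-- any norm on matrices serves, as it only has to induce the entrywise topology
attribute [local instance] Matrix.normedAddCommGroup Matrix.normedSpace in
lemma isAttractive_of_unique (hH : H.IsHermitian) {ρss : Matrix (Fin N) (Fin N) ℂ}
    (hss : IsSteadyState H V ρss)
    (huniq : ∀ ρ : Matrix (Fin N) (Fin N) ℂ, IsSteadyState H V ρ → ρ = ρss) :
    IsAttractive H V ρss := by
  intro ρ hρ
  have hK := effectiveOperator_add_conjTranspose (V := V) hH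
  have hLss : schrodingerMap (effectiveOperator H V) V ρss = 0 := by
    rw [← generator_eq_schrodingerMap hH, hss.2]
  let F := LinearMap.toContinuousLinearMap (shiftedMap (effectiveOperator H V) V ρss)
  have hF : ∀ (z : ℂ) (X : Matrix (Fin N) (Fin N) ℂ), X ≠ 0 → F X = z • X → z.re < 0 :=
    fun z X hX h => re_neg_of_shiftedMap_eq_smul hK hss.1.1 hss.1.2 hLss
      (eq_of_schrodingerMap_eq_zero hH huniq) hX h
  have hdiff : Tendsto (fun t => ρ t - ρss) atTop (𝓝 0) := by
    refine tendsto_zero_of_hasDerivWithinAt hF fun t ht => ?_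
    -- the difference of two states is traceless, so the shift does not act on it
    have hFt : F (ρ t - ρss) = generator H V (ρ t) := by
      change shiftedMap (effectiveOperator H V) V ρss (ρ t - ρss) = _
      rw [shiftedMap_apply, map_sub, hLss, trace_sub, hρ.trace_eq_one hH ht, hss.1.2, sub_self,
        zero_smul, sub_zero, sub_zero, generator_eq_schrodingerMap hH]
    have hderiv : HasDerivWithinAt (fun s => ρ s - ρss) (generator H V (ρ t)) (Ici 0) t :=
      hasDerivWithinAt_pi.mpr fun i => hasDerivWithinAt_pi.mpr fun j =>
        (hρ.evolution t ht i j).sub_const _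
    exact hderiv.congr_deriv hFt.symm
  simpa using hdiff.add_const ρss

end MasterEquation

/-! ### The Bloch operator -/

section BlochOperator

variable {N : ℕ} {ι : Type*} [Fintype ι] {H : Matrix (Fin N) (Fin N) ℂ}
  {V : ι → Matrix (Fin N) (Fin N) ℂ} {σ : Fin (N ^ 2 - 1) → Matrix (Fin N) (Fin N) ℂ}

lemma _root_.Matrix.IsHermitian.ofReal_re_trace_mul {A B : Matrix (Fin N) (Fin N) ℂ}
    (hA : A.IsHermitian) (hB : B.IsHermitian) : (((A * B).trace.re : ℝ) : ℂ) = (A * B).trace := by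
  refine Complex.conj_eq_iff_re.mp ?_
  have := trace_conjTranspose (A * B)
  rw [conjTranspose_mul, hA.eq, hB.eq, trace_mul_comm] at this
  exact this.symm

/-- The Bloch operator is the matrix of the generator in the basis `σ`. -/
lemma ofReal_blochOperator (hH : H.IsHermitian) (hσ : IsBlochBasis σ) (m n : Fin (N ^ 2 - 1)) :
    ((blochOperator H V σ m n : ℝ) : ℂ) = (σ m * generator H V (σ n)).trace := by
  have hLσ : (generator H V (σ n)).IsHermitian := by
    rw [IsHermitian, generator_eq_schrodingerMap hH, ← schrodingerMap_conjTranspose,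
      (hσ.isHermitian n).eq]
  rw [← (hσ.isHermitian m).ofReal_re_trace_mul hLσ, blochOperator, of_apply]
  refine congrArg (fun w : ℂ => ((w.re : ℝ) : ℂ)) ?_
  have h3 : ∀ W : Matrix (Fin N) (Fin N) ℂ,
      (Wᴴ * σ m * W * σ n).trace = (σ m * (W * σ n * Wᴴ)).trace := fun W => by
    rw [Matrix.mul_assoc, Matrix.mul_assoc, trace_mul_comm, Matrix.mul_assoc]
  have h4 : ∀ W : Matrix (Fin N) (Fin N) ℂ, (W * (σ m * σ n)).trace = (σ m * (σ n * W)).trace :=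
    fun W => by rw [trace_mul_comm, Matrix.mul_assoc]
  have h5 : ∀ W : Matrix (Fin N) (Fin N) ℂ, (W * (σ n * σ m)).trace = (σ m * (W * σ n)).trace :=
    fun W => by rw [← Matrix.mul_assoc, trace_mul_comm]
  simp only [generator, dissipator, Matrix.mul_add, Matrix.mul_sum, trace_add, trace_sum,
    Matrix.mul_sub, trace_sub, Matrix.mul_smul, Matrix.smul_mul, trace_smul, smul_eq_mul, h3, h4,
    h5]
  refine congrArg₂ (· + ·) (by ring) (Finset.sum_congr rfl fun d _ => by ring)

/-- The `σ k` together with the identity span all matrices, by a dimension count. -/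
lemma IsBlochBasis.eq_zero_of_forall_trace_mul_eq_zero (hN : 0 < N) (hσ : IsBlochBasis σ)
    {Y : Matrix (Fin N) (Fin N) ℂ} (hY : ∀ k, (σ k * Y).trace = 0) (hYtr : Y.trace = 0) :
    Y = 0 := by
  let F : Matrix (Fin N) (Fin N) ℂ →ₗ[ℂ] (Fin (N ^ 2 - 1) → ℂ) × ℂ :=
    (LinearMap.pi fun k => traceLinearMap (Fin N) ℂ ℂ ∘ₗ LinearMap.mulLeft ℂ (σ k)).prod
      (traceLinearMap (Fin N) ℂ ℂ)
  have hF : ∀ X, F X = (fun k => (σ k * X).trace, X.trace) := fun X => rfl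
  -- the preimage of `(a, b)` is read off from orthonormality, as `1` is orthogonal to every `σ k`
  have hsurj : Function.Surjective F := by
    rintro ⟨a, b⟩
    refine ⟨∑ k, a k • σ k + (b / N) • 1, ?_⟩
    rw [hF]
    ext1
    · funext k
      simp [Matrix.mul_add, Matrix.mul_sum, trace_sum, hσ.orthonormal, hσ.trace_eq_zero]
    · have : (N : ℂ) ≠ 0 := Nat.cast_ne_zero.mpr hN.ne'
      simp [trace_sum, hσ.trace_eq_zero, this]
  have hdim : Module.finrank ℂ (Matrix (Fin N) (Fin N) ℂ)
      = Module.finrank ℂ ((Fin (N ^ 2 - 1) → ℂ) × ℂ) := by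
    have : 0 < N ^ 2 := by positivity
    simp [Module.finrank_matrix]
    rw [← sq]; omega
  have hinj := (LinearMap.injective_iff_surjective_of_finrank_eq_finrank hdim).mpr hsurj
  refine hinj ?_
  rw [map_zero, hF, hYtr]
  ext1
  · exact funext hY
  · rfl

/-- A complex eigenvalue of the Bloch operator is an eigenvalue of the generator on traceless
matrices. -/
lemma exists_eigenvector_of_isComplexEigenvalue (hN : 0 < N) (hH : H.IsHermitian)
    (hσ : IsBlochBasis σ) {z : ℂ} (h : IsComplexEigenvalue (blochOperator H V σ) z) :
    ∃ X : Matrix (Fin N) (Fin N) ℂ, X ≠ 0 ∧ X.trace = 0 ∧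
      schrodingerMap (effectiveOperator H V) V X = z • X := by
  obtain ⟨x, hx⟩ := Module.End.HasEigenvalue.exists_hasEigenvector h
  have hAx : (blochOperator H V σ).map Complex.ofReal *ᵥ x = z • x := by
    rw [← toLin'_apply]; exact hx.apply_eq_smul
  set X := ∑ k, x k • σ k with hX
  have hσX : ∀ m, (σ m * X).trace = x m := by
    intro m
    simp [hX, Matrix.mul_sum, trace_sum, hσ.orthonormal]
  have hXtr : X.trace = 0 := by simp [hX, trace_sum, hσ.trace_eq_zero]
  refine ⟨X, ?_, hXtr, ?_⟩
  · intro h0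
    refine hx.2 (funext fun m => ?_)
    rw [← hσX, h0]; simp
  · refine sub_eq_zero.mp (hσ.eq_zero_of_forall_trace_mul_eq_zero hN (fun m => ?_) ?_)
    · have h1 := congrFun hAx m
      simp only [mulVec, dotProduct, map_apply, ofReal_blochOperator hH hσ,
        generator_eq_schrodingerMap hH, Pi.smul_apply, smul_eq_mul] at h1
      rw [Matrix.mul_sub, trace_sub, Matrix.mul_smul, trace_smul, hσX, smul_eq_mul, ← h1, hX,
        map_sum, Matrix.mul_sum, trace_sum, sub_eq_zero]
      refine Finset.sum_congr rfl fun k _ => ?_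
      rw [map_smul, Matrix.mul_smul, trace_smul, smul_eq_mul, mul_comm]
    · rw [trace_sub, trace_schrodingerMap (effectiveOperator_add_conjTranspose hH), trace_smul,
        hXtr, smul_zero, sub_zero]

lemma re_neg_of_isComplexEigenvalue (hH : H.IsHermitian) {ρss : Matrix (Fin N) (Fin N) ℂ}
    (hss : IsSteadyState H V ρss)
    (huniq : ∀ ρ : Matrix (Fin N) (Fin N) ℂ, IsSteadyState H V ρ → ρ = ρss)
    (hσ : IsBlochBasis σ) {z : ℂ} (h : IsComplexEigenvalue (blochOperator H V σ) z) :
    z.re < 0 := by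
  have hN : 0 < N := by
    rcases Nat.eq_zero_or_pos N with rfl | hN
    · have := hss.1.2
      simp [trace] at this
    · exact hN
  obtain ⟨X, hX, hXtr, hLX⟩ := exists_eigenvector_of_isComplexEigenvalue hN hH hσ h
  exact re_neg_of_schrodingerMap_eq_smul (effectiveOperator_add_conjTranspose hH) hss.1.1 hss.1.2
    (by rw [← generator_eq_schrodingerMap hH, hss.2]) (eq_of_schrodingerMap_eq_zero hH huniq)
    hX hXtr hLX

end BlochOperator

end Lindblad

theorem mainTheorem1 {N : ℕ} {ι : Type*} [Fintype ι]
    (H : Matrix (Fin N) (Fin N) ℂ) (hH : H.IsHermitian)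
    (V : ι → Matrix (Fin N) (Fin N) ℂ)
    (ρss : Matrix (Fin N) (Fin N) ℂ) (hss : Lindblad.IsSteadyState H V ρss) :
    (Lindblad.IsAttractive H V ρss ↔
      ∀ ρ : Matrix (Fin N) (Fin N) ℂ, Lindblad.IsSteadyState H V ρ → ρ = ρss) ∧
    ((∀ ρ : Matrix (Fin N) (Fin N) ℂ, Lindblad.IsSteadyState H V ρ → ρ = ρss) →
      ∀ σ : Fin (N ^ 2 - 1) → Matrix (Fin N) (Fin N) ℂ, Lindblad.IsBlochBasis σ →
        ∀ α : ℝ, 0 < α →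
          ¬ Lindblad.IsComplexEigenvalue (Lindblad.blochOperator H V σ) (Complex.I * α) ∧
          ¬ Lindblad.IsComplexEigenvalue (Lindblad.blochOperator H V σ) (-(Complex.I * α))) := by
  refine ⟨⟨fun h ρ hρ => h.eq_of_isSteadyState hρ, Lindblad.isAttractive_of_unique hH hss⟩,
    fun huniq σ hσ α _ => ⟨fun h => ?_, fun h => ?_⟩⟩
  · simpa using Lindblad.re_neg_of_isComplexEigenvalue hH hss huniq hσ h
  · simpa using Lindblad.re_neg_of_isComplexEigenvalue hH hss huniq hσ h
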